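/- Let $(M,g)$ be a smooth Riemannian $3$-manifold, possibly with boundary or corners and not necessarily orientable or compact (Hausdorff, $\sigma$-compact). A twisted form (resp. a pseudovector field) is a form (resp. vector field) that depends on a choice of orientation of the tangent space and changes sign with it; $\mathbf{vol}^3$ is the Riemannian volume form, a twisted $3$-form, and $\int_M$ of a twisted $3$-form (density) needs no orientation. For a smooth vector field $D$ and a smooth pseudovector field $B$ let $\tilde d^2=\mathbf i_D\mathbf{vol}^3$ (twisted) and $b^2=\mathbf i_B\mathbf{vol}^3$ (straight). The curl is defined by $\mathsf d(V^\flat)=\mathbf i_{\nabla\times V}\mathbf{vol}^3$, the dot product is $g$, and $\langle\omega,\tau\rangle=\int_M\omega\wedge\tau$ is the pairing of a straight form with a twisted form of complementary degree. Let $F,G$ be real functionals of $(D,B)$, regarded also as functionals of $(\tilde d^2,b^2)$ through this correspondence. At a point $(D,B)$ a smooth vector field $\frac{\delta F}{\delta D}$ and a smooth pseudovector field $\frac{\delta F}{\delta B}$ are the functional derivatives of $F$ if $$\tfrac{d}{d\varepsilon}\Big|_{0}F[D+\varepsilon U,B]=\int_M\tfrac{\delta F}{\delta D}\cdot U\,\mathbf{vol}^3,\qquad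 \tfrac{d}{d\varepsilon}\Big|_{0}F[D,B+\varepsilon V]=\int_M\tfrac{\delta F}{\delta B}\cdot V\,\mathbf{vol}^3$$ for all smooth variations $U$ (vector) and $V$ (pseudovector) with compact support in the interior of $M$. Likewise a smooth straight $1$-form $\frac{\tilde\delta F}{\delta\tilde d^2}$ and a smooth twisted $1$-form $\frac{\tilde\delta F}{\delta b^2}$ are the twisted functional derivatives of $F$ at $(\tilde d^2,b^2)$ if $$\tfrac{d}{d\varepsilon}\Big|_{0}F[\tilde d^2+\varepsilon\tilde u,b^2]=\Big\langle\tfrac{\tilde\delta F}{\delta\tilde d^2},\tilde u\Big\rangle,\qquad \tfrac{d}{d\varepsilon}\Big|_{0}F[\tilde d^2,b^2+\varepsilon v]=\Big\langle v,\tfrac{\tilde\delta F}{\delta b^2}\Big\rangle$$ for all smooth twisted $2$-forms $\tilde u$ and straight $2$-forms $v$ with compact support in the interior of $M$. Suppose that $F$ and $G$ have functional derivatives with respect to $D$ and $B$ at $(D,B)$, and that the densities $\frac{\delta F}{\delta D}\cdot\nabla\times\frac{\delta G}{\delta B}\,\mathbf{vol}^3$ and $\frac{\delta G}{\delta D}\cdot\nabla\times\frac{\delta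 F}{\delta B}\,\mathbf{vol}^3$ are absolutely integrable over $M$ (which is automatic if $M$ is compact). Then $F$ and $G$ have unique twisted functional derivatives with respect to $\tilde d^2$ and $b^2$ at the corresponding $(\tilde d^2,b^2)$, the pairings below converge absolutely, and for every real constant $c$ $$4\pi c\left[\left\langle\frac{\tilde\delta F}{\delta\tilde d^2},\mathsf d\frac{\tilde\delta G}{\delta b^2}\right\rangle-\left\langle\frac{\tilde\delta G}{\delta\tilde d^2},\mathsf d\frac{\tilde\delta F}{\delta b^2}\right\rangle\right]=4\pi c\int_M\left[\frac{\delta F}{\delta D}\cdot\nabla\times\frac{\delta G}{\delta B}-\frac{\delta G}{\delta D}\cdot\nabla\times\frac{\delta F}{\delta B}\right]\mathbf{vol}^3 .$$ -/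

import Mathlib

open scoped Manifold ContDiff Topology
open MeasureTheory Bundle

noncomputable section

namespace SplitMaxwell

/-- The model space `ℝ³`, with its standard basis and Lebesgue measure. -/
abbrev E3 := EuclideanSpace ℝ (Fin 3)

/-! ### Exterior algebra on a real vector space -/

section Algebra

variable {T : Type*} [AddCommGroup T] [Module ℝ T]

/-- The wedge product of alternating forms: the sum over `(k, l)`-shuffles, without any
normalising factor, so that `dx¹ ∧ dx² ∧ dx³ (e₁, e₂, e₃) = 1`. -/
def wedge {k l m : ℕ} (h : k + l = m) (α : T [⋀^Fin k]→ₗ[ℝ] ℝ) (β : T [⋀^Fin l]→ₗ[ℝ] ℝ) :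
    T [⋀^Fin m]→ₗ[ℝ] ℝ :=
  ((LinearMap.mul' ℝ ℝ).compAlternatingMap (α.domCoprod β)).domDomCongr
    (finSumFinEquiv.trans (finCongr h))

end Algebra

/-- Every alternating form on `ℝ³` is continuous. -/
theorem continuous_altForm {k : ℕ} (η : E3 [⋀^Fin k]→ₗ[ℝ] ℝ) :
    Continuous η.toMultilinearMap.toFun := by
  have h : ∀ v : Fin k → E3, η.toMultilinearMap v =
      ∑ r : Fin k → Fin 3, (∏ i, (v i) (r i)) •
        η.toMultilinearMap (fun i => EuclideanSpace.basisFun (Fin 3) ℝ (r i)) := by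
    intro v
    have hv : v = fun i => ∑ j : Fin 3, (v i) j • EuclideanSpace.basisFun (Fin 3) ℝ j := by
      funext i
      exact ((EuclideanSpace.basisFun (Fin 3) ℝ).sum_repr (v i)).symm
    conv_lhs => rw [hv]
    rw [MultilinearMap.map_sum]
    exact Finset.sum_congr rfl fun r _ => by rw [MultilinearMap.map_smul_univ]
  change Continuous fun v => η.toMultilinearMap v
  rw [funext h]
  fun_prop

/-- An alternating form on `ℝ³`, regarded as a continuous alternating form. -/
def toCont {k : ℕ} (η : E3 [⋀^Fin k]→ₗ[ℝ] ℝ) : E3 [⋀^Fin k]→L[ℝ] ℝ :=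
  { η with cont := continuous_altForm η }

section Manifold

variable {H : Type*} [TopologicalSpace H] (I : ModelWithCorners ℝ E3 H)
  {M : Type*} [TopologicalSpace M] [ChartedSpace H M]

/-- An orientation of the tangent space at `x`. -/
abbrev Orient (x : M) := Orientation ℝ (TangentSpace I x) (Fin 3)

/-- Alternating `k`-forms on the tangent space at `x`. -/
abbrev Alt (k : ℕ) (x : M) := TangentSpace I x [⋀^Fin k]→ₗ[ℝ] ℝ

variable [IsManifold I ∞ M]

/-! ### Coordinate frames and orientations -/

/-- The local trivialisation of the tangent bundle given by the chart `φ` at `x₀`; over a point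
`x` of the chart domain its linear part is the derivative of `φ` at `x`. -/
abbrev triv (x₀ : M) : Trivialization E3 (TotalSpace.proj : TangentBundle I M → M) :=
  trivializationAt E3 (TangentSpace I) x₀

/-- The coordinate frame `(∂₁, ∂₂, ∂₃)` of the chart at `x₀`, at a point `x` of its domain. -/
def coordBasis (x₀ x : M) (hx : x ∈ (triv I x₀).baseSet) :
    Module.Basis (Fin 3) ℝ (TangentSpace I x) :=
  (EuclideanSpace.basisFun (Fin 3) ℝ).toBasis.map ((triv I x₀).linearEquivAt ℝ x hx).symm

/-- The coordinate frame, at `x`, of the preferred chart at `x`. -/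
def stdBasis (x : M) : Module.Basis (Fin 3) ℝ (TangentSpace I x) :=
  coordBasis I x x (FiberBundle.mem_baseSet_trivializationAt' x)

open scoped Classical in
/-- The orientation at `x` of the coordinate frame of the chart at `x₀` (for `x` in the chart
domain; a junk value elsewhere). -/
def chartOr (x₀ x : M) : Orient I x :=
  if hx : x ∈ (triv I x₀).baseSet then (coordBasis I x₀ x hx).orientation
  else (stdBasis I x).orientation

/-! ### Straight and twisted differential forms

A straight `k`-form assigns to each point an alternating form on the tangent space there. A twisted
`k`-form assigns one to each point and each orientation of the tangent space at this point, and
changes sign when the orientation is reversed. -/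

/-- The coordinate expression `(φ⁻¹)^* η` of a straight form in the chart `φ` at `x₀`. -/
def rep {k : ℕ} (η : Π x : M, Alt I k x) (x₀ : M) (y : E3) : E3 [⋀^Fin k]→ₗ[ℝ] ℝ :=
  (η ((extChartAt I x₀).symm y)).compLinearMap
    ((triv I x₀).symmL ℝ ((extChartAt I x₀).symm y)).toLinearMap

/-- The coordinate expression of a twisted form in the chart `φ` at `x₀`, with respect to the
orientation given by this chart. -/
def repTw {k : ℕ} (τ : Π x : M, Orient I x → Alt I k x) (x₀ : M) (y : E3) :
    E3 [⋀^Fin k]→ₗ[ℝ] ℝ :=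
  rep I (fun x => τ x (chartOr I x₀ x)) x₀ y

variable (M) in
/-- The space `Λᵏ` of smooth straight `k`-forms. -/
def Form (k : ℕ) : Submodule ℝ (Π x : M, Alt I k x) where
  carrier := {η | ∀ (x₀ : M) (v : Fin k → E3),
    ContDiffOn ℝ ∞ (fun y => rep I η x₀ y v) (extChartAt I x₀).target}
  add_mem' h₁ h₂ := fun x₀ v => (h₁ x₀ v).add (h₂ x₀ v)
  zero_mem' := fun _ _ => contDiffOn_const
  smul_mem' _ _ h := fun x₀ v => contDiffOn_const.mul (h x₀ v)

variable (M) in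
/-- The space of smooth twisted `k`-forms. -/
def TwistedForm (k : ℕ) : Submodule ℝ (Π x : M, Orient I x → Alt I k x) where
  carrier := {τ | (∀ x o, τ x (-o) = -τ x o) ∧ ∀ (x₀ : M) (v : Fin k → E3),
    ContDiffOn ℝ ∞ (fun y => repTw I τ x₀ y v) (extChartAt I x₀).target}
  add_mem' h₁ h₂ := ⟨fun x o => by simp only [Pi.add_apply, h₁.1 x o, h₂.1 x o, neg_add],
    fun x₀ v => (h₁.2 x₀ v).add (h₂.2 x₀ v)⟩
  zero_mem' := ⟨fun _ _ => by simp, fun _ _ => contDiffOn_const⟩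
  smul_mem' c _ h := ⟨fun x o => by simp only [Pi.smul_apply, h.1 x o, smul_neg],
    fun x₀ v => contDiffOn_const.mul (h.2 x₀ v)⟩

variable (M) in
/-- The space of smooth vector fields. -/
abbrev VectorField := ContMDiffSection I E3 ∞ (TangentSpace I : M → Type _)

variable (M) in
/-- The space of smooth pseudovector fields: vector fields depending on an orientation of
the tangent space, and changing sign with it. -/
def PseudoVectorField : Submodule ℝ (Π x : M, Orient I x → TangentSpace I x) where
  carrier := {B | (∀ x o, B x (-o) = -B x o) ∧ ∀ x₀ : M,
    ContMDiffOn I I.tangent ∞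
      (fun x => (⟨x, B x (chartOr I x₀ x)⟩ : TangentBundle I M)) (chartAt H x₀).source}
  add_mem' h₁ h₂ := ⟨fun x o => by simp only [Pi.add_apply, h₁.1 x o, h₂.1 x o, neg_add],
    fun x₀ => (h₁.2 x₀).add_section (h₂.2 x₀)⟩
  zero_mem' := ⟨fun _ _ => by simp, fun _ => contMDiffOn_zeroSection ℝ _⟩
  smul_mem' c _ h := ⟨fun x o => by simp only [Pi.smul_apply, h.1 x o, smul_neg],
    fun x₀ => (h.2 x₀).const_smul_section⟩

open scoped Classical in
/-- The exterior derivative of a twisted form. At `x` it is computed in the chart `φ` at `x`,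
with the orientation of this chart, as `φ^* d((φ⁻¹)^* τ)`. -/
def dTw {k : ℕ} (τ : Π x : M, Orient I x → Alt I k x) (x : M) (o : Orient I x) : Alt I (k + 1) x :=
  (if o = chartOr I x x then (1 : ℝ) else -1) •
    (extDerivWithin (fun y => toCont (repTw I τ x y)) (Set.range I)
      (extChartAt I x x)).toAlternatingMap.compLinearMap
        ((triv I x).continuousLinearMapAt ℝ x).toLinearMap

/-! ### Integration of densities

A density is a twisted `3`-form. Its integral over `M` is computed in charts, with a smooth
partition of unity subordinate to the chart domains; no metric and no orientation is involved. -/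

section Integral

variable [T2Space M] [SigmaCompactSpace M]

variable (M) in
/-- A smooth partition of unity subordinate to the chart domains. -/
def partUnity : SmoothPartitionOfUnity M I M Set.univ :=
  (SmoothPartitionOfUnity.exists_isSubordinate_chartAt_source I M).choose

variable (M) in
theorem partUnity_isSubordinate :
    (partUnity I M).IsSubordinate (fun x => (chartAt H x).source) :=
  (SmoothPartitionOfUnity.exists_isSubordinate_chartAt_source I M).choose_spec

/-- The coordinate expression, in the chart at `i`, of the density `ρ` cut off by the `i`-th
function of the partition of unity. -/
def localDensity (ρ : Π x : M, Orient I x → Alt I 3 x) (i : M) (y : E3) : ℝ :=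
  partUnity I M i ((extChartAt I i).symm y) *
    repTw I ρ i y (fun j => EuclideanSpace.basisFun (Fin 3) ℝ j)

/-- Absolute integrability of a density over `M`. -/
def DensityIntegrable (ρ : Π x : M, Orient I x → Alt I 3 x) : Prop :=
  (∀ i : M, IntegrableOn (localDensity I ρ i) (extChartAt I i).target) ∧
    Summable fun i : M => ∫ y in (extChartAt I i).target, |localDensity I ρ i y|

/-- The integral of a density over `M`. -/
def densityIntegral (ρ : Π x : M, Orient I x → Alt I 3 x) : ℝ :=
  ∑' i : M, ∫ y in (extChartAt I i).target, localDensity I ρ i y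

/-- The density `η ∧ τ` for a straight form `η` and a twisted form `τ` of complementary degree. -/
def wedgeDensity {k l : ℕ} (h : k + l = 3) (η : Π x : M, Alt I k x)
    (τ : Π x : M, Orient I x → Alt I l x) (x : M) (o : Orient I x) : Alt I 3 x :=
  wedge h (η x) (τ x o)

/-- The Poincaré duality pairing `⟨η, τ⟩ = ∫ η ∧ τ`. -/
def pairing {k l : ℕ} (h : k + l = 3) (η : Π x : M, Alt I k x)
    (τ : Π x : M, Orient I x → Alt I l x) : ℝ :=
  densityIntegral I (wedgeDensity I h η τ)

end Integral

/-! ### Vector calculus of a Riemannian metric -/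

section Metric

variable {I}
variable (g : ContMDiffRiemannianMetric I ∞ E3 (TangentSpace I : M → Type _))

/-- The `1`-form `v♭ = g(v, ·)` on the tangent space at `x`. -/
def flat (x : M) (v : TangentSpace I x) : Alt I 1 x :=
  AlternatingMap.ofSubsingleton ℝ (TangentSpace I x) ℝ (0 : Fin 1) (g.inner x v).toLinearMap

/-- The factor `√(det (g(bᵢ, bⱼ)))` for a frame `b` at `x`. -/
def sqrtGram (x : M) (b : Fin 3 → TangentSpace I x) : ℝ :=
  Real.sqrt (Matrix.of fun i j => g.inner x (b i) (b j)).det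

/-- The Riemannian volume form, a twisted `3`-form: for a frame `b` with orientation `o`, and its
dual coframe `dx¹, dx², dx³`, it is `√(det g) dx¹ ∧ dx² ∧ dx³`. -/
def vol (x : M) (o : Orient I x) : Alt I 3 x :=
  sqrtGram g x ((stdBasis I x).adjustToOrientation o) • ((stdBasis I x).adjustToOrientation o).det

/-- The interior product `i_v vol`, for an orientation `o` of the tangent space at `x`. -/
def flux (x : M) (o : Orient I x) (v : TangentSpace I x) : Alt I 2 x :=
  (vol g x o).curryLeft v

/-- The curl of a pseudovector field `A`, a vector field: in the coordinate frame `b` of the chart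
at `x` it is `(√(det g))⁻¹ ∑ᵢ d(A♭)(bᵢ₊₁, bᵢ₊₂) bᵢ`, with indices modulo 3. It is characterised by
`i_{curl A} vol = d(A♭)`; see `flux_curl`. -/
def curl (A : Π x : M, Orient I x → TangentSpace I x) (x : M) : TangentSpace I x :=
  (sqrtGram g x (stdBasis I x))⁻¹ • ∑ i : Fin 3,
    dTw I (fun x o => flat g x (A x o)) x (stdBasis I x).orientation
      ![stdBasis I x (i + 1), stdBasis I x (i + 2)] • stdBasis I x i

theorem sqrtGram_pos (x : M) (b : Module.Basis (Fin 3) ℝ (TangentSpace I x)) :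
    0 < sqrtGram g x b := by
  refine Real.sqrt_pos.2 (Matrix.PosDef.det_pos ?_)
  refine Matrix.PosDef.of_dotProduct_mulVec_pos ?_ ?_
  · ext i j
    simp [g.symm x (b i) (b j)]
  · intro u hu
    have hv : ∑ i, u i • b i ≠ 0 := fun h0 =>
      hu (funext (Fintype.linearIndependent_iff.1 b.linearIndependent u h0))
    have h := g.pos x _ hv
    have he : g.inner x (∑ i, u i • b i) (∑ i, u i • b i) =
        dotProduct (star u) (Matrix.mulVec (Matrix.of fun i j => g.inner x (b i) (b j)) u) := by
      simp only [map_sum, map_smul, sum_apply, smul_apply,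
        smul_eq_mul, dotProduct, Matrix.mulVec, Matrix.of_apply, Pi.star_apply, star_trivial,
        Finset.mul_sum]
      rw [Finset.sum_comm]
      refine Finset.sum_congr rfl fun i _ => Finset.sum_congr rfl fun j _ => by ring
    rwa [he] at h

theorem sqrtGram_adjust (x : M) (b : Module.Basis (Fin 3) ℝ (TangentSpace I x)) (o : Orient I x) :
    sqrtGram g x (b.adjustToOrientation o) = sqrtGram g x b := by
  choose s hs using fun i : Fin 3 => show ∃ s : ℝ, s * s = 1 ∧
      b.adjustToOrientation o i = s • b i by
    rcases b.adjustToOrientation_apply_eq_or_eq_neg o i with h | h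
    · exact ⟨1, by norm_num, by simp [h]⟩
    · exact ⟨-1, by norm_num, by simp [h]⟩
  unfold sqrtGram
  congr 1
  simp only [(hs _).2, map_smul, smul_apply, smul_eq_mul,
    Matrix.det_fin_three, Matrix.of_apply]
  have h0 := (hs 0).1
  have h1 := (hs 1).1
  have h2 := (hs 2).1
  linear_combination
    (norm := ring_nf) (Matrix.of fun i j => g.inner x (b i) (b j)).det *
      ((s 1 * s 1) * (s 2 * s 2) * h0 + (s 2 * s 2) * h1 + h2)
  simp only [Matrix.det_fin_three, Matrix.of_apply]
  ring

theorem chartOr_self (x : M) : chartOr I x x = (stdBasis I x).orientation := by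
  rw [chartOr, dif_pos (FiberBundle.mem_baseSet_trivializationAt' x)]
  rfl

theorem vol_std (x : M) : vol g x (stdBasis I x).orientation =
    sqrtGram g x (stdBasis I x) • (stdBasis I x).det := by
  rw [vol, sqrtGram_adjust, Module.Basis.adjustToOrientation, if_pos rfl]

theorem vol_neg_std (x : M) : vol g x (-(stdBasis I x).orientation) =
    -(sqrtGram g x (stdBasis I x) • (stdBasis I x).det) := by
  rw [vol, sqrtGram_adjust]
  rcases (stdBasis I x).det_adjustToOrientation (-(stdBasis I x).orientation) with h | h
  · exfalso
    have h1 := (stdBasis I x).orientation_adjustToOrientation (-(stdBasis I x).orientation)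
    have h2 : ((stdBasis I x).adjustToOrientation (-(stdBasis I x).orientation)).orientation =
        (stdBasis I x).orientation := by
      unfold Module.Basis.orientation
      congr 1
    exact Module.Ray.ne_neg_self _ (h2.symm.trans h1)
  · rw [h, smul_neg]

/-- The curl of `A` is the vector field whose interior product with the volume form is the exterior
derivative of `A♭`. -/
theorem flux_curl (A : Π x : M, Orient I x → TangentSpace I x) (x : M) (o : Orient I x) :
    flux g x o (curl g A x) = dTw I (fun x o => flat g x (A x o)) x o := by
  have key : flux g x (stdBasis I x).orientation (curl g A x) =
      dTw I (fun x o => flat g x (A x o)) x (stdBasis I x).orientation := by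
    unfold curl
    generalize dTw I (fun x o => flat g x (A x o)) x (stdBasis I x).orientation = β
    have hs := (sqrtGram_pos g x (stdBasis I x)).ne'
    rw [flux, vol_std]
    generalize sqrtGram g x (stdBasis I x) = s at *
    generalize stdBasis I x = b
    refine b.ext_alternating fun v hv => ?_
    have hβ : ∀ i j, β ![b i, b j] = -β ![b j, b i] := fun i j => by
      have := β.map_swap ![b j, b i] (i := 0) (j := 1) (by decide)
      rw [← this]
      congr 1
      ext k
      fin_cases k <;> simp
    have hv2 : (fun i => b (v i)) = ![b (v 0), b (v 1)] := by
      ext k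
      fin_cases k <;> rfl
    have hne : v 0 ≠ v 1 := fun h => absurd (hv h) (by decide)
    rw [hv2]
    generalize v 0 = p at *
    generalize v 1 = q at *
    simp only [AlternatingMap.curryLeft_apply_apply, AlternatingMap.smul_apply, smul_eq_mul,
      Module.Basis.det_apply, Matrix.det_fin_three, Module.Basis.toMatrix_apply]
    fin_cases p <;> fin_cases q <;>
      simp [Fin.sum_univ_three, hs] at hne ⊢ <;>
      first
        | rfl
        | exact (hβ _ _).symm
  rcases (stdBasis I x).orientation_eq_or_eq_neg o with rfl | rfl
  · exact key
  · have h1 : flux g x (-(stdBasis I x).orientation) (curl g A x) =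
        -flux g x (stdBasis I x).orientation (curl g A x) := by
      ext v
      simp [flux, vol_std, vol_neg_std]
    rw [h1, key]
    rw [dTw, dTw, chartOr_self, if_pos rfl, if_neg (Module.Ray.ne_neg_self _).symm, one_smul,
      neg_one_smul]

/-- The density `f vol`. -/
def volDensity (f : Π x : M, Orient I x → ℝ) (x : M) (o : Orient I x) : Alt I 3 x :=
  f x o • vol g x o

/-! ### Functional derivatives

Functionals are differentiated in the direction of smooth variations with compact support in the
interior of `M`. -/

variable [T2Space M] [SigmaCompactSpace M]

variable (I) in
/-- The set `S` is contained in a compact subset of the interior of `M`. -/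
def CompactInInterior (S : Set M) : Prop :=
  ∃ K : Set M, IsCompact K ∧ K ⊆ I.interior M ∧ S ⊆ K

/-- `A = δK/δD` for a functional of a vector field: `DK[D] U = ∫ A · U vol`. -/
def HasVectorDeriv (K : VectorField I M → ℝ) (D A : VectorField I M) : Prop :=
  ∀ U : VectorField I M, CompactInInterior I {x | U x ≠ 0} →
    HasDerivAt (fun ε : ℝ => K (D + ε • U))
      (densityIntegral I (volDensity g fun x _ => g.inner x (A x) (U x))) 0

/-- `A = δK/δB` for a functional of a pseudovector field: `DK[B] U = ∫ A · U vol`. -/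
def HasPseudoVectorDeriv (K : PseudoVectorField I M → ℝ) (B A : PseudoVectorField I M) : Prop :=
  ∀ U : PseudoVectorField I M, CompactInInterior I {x | U.1 x ≠ 0} →
    HasDerivAt (fun ε : ℝ => K (B + ε • U))
      (densityIntegral I (volDensity g fun x o => g.inner x (A.1 x o) (U.1 x o))) 0

/-- The straight form `α` is the twisted functional derivative, at the twisted form `d`, of a
functional of twisted forms: `DK[d] u = ⟨α, u⟩`. -/
def HasDerivAtTwisted {k l : ℕ} (h : l + k = 3) (K : TwistedForm I M k → ℝ)
    (d : TwistedForm I M k) (α : Form I M l) : Prop :=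
  ∀ u : TwistedForm I M k, CompactInInterior I {x | u.1 x ≠ 0} →
    HasDerivAt (fun ε : ℝ => K (d + ε • u)) (pairing I h α.1 u.1) 0

/-- The twisted form `β` is the twisted functional derivative, at the straight form `b`, of a
functional of straight forms: `DK[b] u = ⟨u, β⟩`. -/
def HasDerivAtStraight {k l : ℕ} (h : k + l = 3) (K : Form I M k → ℝ)
    (b : Form I M k) (β : TwistedForm I M l) : Prop :=
  ∀ u : Form I M k, CompactInInterior I {x | u.1 x ≠ 0} →
    HasDerivAt (fun ε : ℝ => K (b + ε • u)) (pairing I h u.1 β.1) 0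

/-! ### The two formulations and their brackets -/

variable (I M) in
/-- The vector calculus variables `(D, B)`. -/
abbrev VectorState := VectorField I M × PseudoVectorField I M

variable (I M) in
/-- The exterior calculus variables: a twisted `2`-form `d` and a straight `2`-form `b`. -/
abbrev FormState := TwistedForm I M 2 × Form I M 2

variable (I M) in
/-- The pairs (straight `1`-form, twisted `1`-form), in which the functional derivatives with
respect to the form variables `(d, b)` lie. -/
abbrev FormCostate := Form I M 1 × TwistedForm I M 1

/-- `d = i_D vol` and `b = i_B vol`. -/
def StatesCorrespond (p : VectorState I M) (q : FormState I M) : Prop :=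
  (∀ x o, q.1.1 x o = flux g x o (p.1 x)) ∧ ∀ x o, q.2.1 x = flux g x o (p.2.1 x o)

/-- `F` and `F'` are the same functional, expressed in the variables `(D, B)` and `(d, b)`. -/
def FunctionalsCorrespond (F : VectorState I M → ℝ) (F' : FormState I M → ℝ) : Prop :=
  ∀ p q, StatesCorrespond g p q → F' q = F p

/-- `A = (δF/δD, δF/δB)` at `p = (D, B)`. -/
def HasVectorDerivs (F : VectorState I M → ℝ) (p A : VectorState I M) : Prop :=
  HasVectorDeriv g (fun D => F (D, p.2)) p.1 A.1 ∧
    HasPseudoVectorDeriv g (fun B => F (p.1, B)) p.2 A.2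

/-- `α` is the pair of the twisted functional derivatives of `F'` with respect to `d` and `b`, at
`q = (d, b)`. -/
def HasFormDerivs (F' : FormState I M → ℝ) (q : FormState I M) (α : FormCostate I M) : Prop :=
  HasDerivAtTwisted (rfl : 1 + 2 = 3) (fun d => F' (d, q.2)) q.1 α.1 ∧
    HasDerivAtStraight (rfl : 2 + 1 = 3) (fun b => F' (q.1, b)) q.2 α.2

/-- The density `(X · curl Y) vol`. -/
def dotCurlDensity (X : VectorField I M) (Y : PseudoVectorField I M) :
    Π x : M, Orient I x → Alt I 3 x :=
  volDensity g fun x _ => g.inner x (X x) (curl g Y.1 x)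

/-- The vector calculus bracket
`4πc ∫ (δF/δD · curl δG/δB - δG/δD · curl δF/δB) vol`, where `A` and `C` are the derivatives of
`F` and `G`. -/
def vectorBracket (c : ℝ) (A C : VectorState I M) : ℝ :=
  4 * Real.pi * c * densityIntegral I (volDensity g fun x _ =>
    g.inner x (A.1 x) (curl g C.2.1 x) - g.inner x (C.1 x) (curl g A.2.1 x))

/-- The exterior calculus bracket `4πc (⟨δF/δd, d δG/δb⟩ - ⟨δG/δd, d δF/δb⟩)`, where `α` and `γ`
are the twisted functional derivatives of `F` and `G`. No metric is involved. -/
def formBracket (c : ℝ) (α γ : FormCostate I M) : ℝ :=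
  4 * Real.pi * c * (pairing I (rfl : 1 + 2 = 3) α.1.1 (dTw I γ.2.1) -
    pairing I (rfl : 1 + 2 = 3) γ.1.1 (dTw I α.2.1))

end Metric
end Manifold
end SplitMaxwell
end

open SplitMaxwell

/-! At each point the metric identifies vectors with `1`-forms through `flat` and, once an
orientation is fixed, with `2`-forms through `flux`. Everything rests on the identity `a♭ ∧ i_v vol
= g(a, v) vol`, valid in either order of the factors (`wedge_flat_flux`, `wedge_flux_flat`). In
coordinates both identifications and their inverses are smooth, so they give linear bijections
between smooth fields and smooth forms that preserve supports. Variations of `(D, B)` and of `(d,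
b)` therefore match, and pairing with `A♭` is the integral of `g(A, U) vol`: the twisted derivatives
are exactly the flats of the vector ones (`hasFormDerivs_iff`).

Uniqueness is the fundamental lemma of the calculus of variations: test with `f • (A - A')`, where
`f` is a bump supported in the interior. This suffices on a manifold with boundary or corners
because the interior is dense.

For the brackets, `flux_curl` gives `A♭ ∧ d(B♭) = (A · curl B) vol` as an equality of densities.
There is no integration by parts and hence no boundary term. Absolute integrability carries over
directly, and it permits splitting the integral of the difference. -/

namespace SplitMaxwell

/-! ### Wedge products of `1`- and `2`-forms in dimension three -/

section WedgeAlgebra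

variable {T : Type*} [AddCommGroup T] [Module ℝ T]

theorem sum_sign_mul_perm_fin_three (f : Fin 3 → Fin 3 → Fin 3 → ℝ) :
    ∑ σ : Equiv.Perm (Fin 3), ((Equiv.Perm.sign σ : ℤ) : ℝ) * f (σ 0) (σ 1) (σ 2) =
      f 0 1 2 - f 1 0 2 - f 2 1 0 - f 0 2 1 + f 1 2 0 + f 2 0 1 := by
  have h : (Finset.univ : Finset (Equiv.Perm (Fin 3))) =
      {1, Equiv.swap 0 1, Equiv.swap 0 2, Equiv.swap 1 2, finRotate 3, (finRotate 3)⁻¹} := by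
    decide
  rw [h, Finset.sum_insert (by decide), Finset.sum_insert (by decide),
    Finset.sum_insert (by decide), Finset.sum_insert (by decide), Finset.sum_insert (by decide),
    Finset.sum_singleton,
    show Equiv.Perm.sign (1 : Equiv.Perm (Fin 3)) = 1 by decide,
    show Equiv.Perm.sign (Equiv.swap (0 : Fin 3) 1) = -1 by decide,
    show Equiv.Perm.sign (Equiv.swap (0 : Fin 3) 2) = -1 by decide,
    show Equiv.Perm.sign (Equiv.swap (1 : Fin 3) 2) = -1 by decide,
    show Equiv.Perm.sign (finRotate 3) = 1 by decide,
    show Equiv.Perm.sign (finRotate 3)⁻¹ = 1 by decide]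
  change ((1 : ℤ) : ℝ) * f 0 1 2 + (((-1 : ℤ) : ℝ) * f 1 0 2 + (((-1 : ℤ) : ℝ) * f 2 1 0 +
    (((-1 : ℤ) : ℝ) * f 0 2 1 + (((1 : ℤ) : ℝ) * f 1 2 0 + ((1 : ℤ) : ℝ) * f 2 0 1)))) = _
  push_cast
  ring

/-- The wedge product as an alternating sum over all permutations. -/
theorem factorial_smul_wedge {k l m : ℕ} (h : k + l = m) (α : T [⋀^Fin k]→ₗ[ℝ] ℝ)
    (β : T [⋀^Fin l]→ₗ[ℝ] ℝ) (v : Fin m → T) :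
    ((k.factorial * l.factorial : ℕ) : ℝ) * wedge h α β v =
      ∑ σ : Equiv.Perm (Fin m), ((Equiv.Perm.sign σ : ℤ) : ℝ) *
        (α (fun i => v (σ (finCongr h (Fin.castAdd l i)))) *
          β (fun i => v (σ (finCongr h (Fin.natAdd k i))))) := by
  -- Each shuffle class contains `k! l!` permutations contributing equally, so the full alternating
  -- sum is that multiple of the shuffle sum.
  have key := congrArg (fun A => LinearMap.mul' ℝ ℝ
    (A (fun i => v ((finSumFinEquiv.trans (finCongr h)) i))))
      (MultilinearMap.domCoprod_alternization_eq α β)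
  rw [AlternatingMap.smul_apply, map_nsmul, nsmul_eq_mul, Fintype.card_fin, Fintype.card_fin] at key
  have hw : wedge h α β v = LinearMap.mul' ℝ ℝ ((α.domCoprod β)
      (fun i => v ((finSumFinEquiv.trans (finCongr h)) i))) := rfl
  rw [hw, ← key, MultilinearMap.alternatization_apply, map_sum]
  refine Fintype.sum_equiv (finSumFinEquiv.trans (finCongr h)).permCongr _ _ fun σ => ?_
  rw [Equiv.Perm.sign_permCongr]
  simp only [MultilinearMap.domDomCongr_apply, MultilinearMap.domCoprod_apply, Units.smul_def,
    Equiv.permCongr_apply]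
  rw [map_zsmul, zsmul_eq_mul, LinearMap.mul'_apply]
  simp

theorem altForm_one_eq (α : T [⋀^Fin 1]→ₗ[ℝ] ℝ) :
    ∃ a : T → ℝ, ∀ f : Fin 1 → T, α f = a (f 0) :=
  ⟨fun x => α fun _ => x, fun f => congrArg α (funext fun i => by rw [Subsingleton.elim i 0])⟩

theorem altForm_two_eq (β : T [⋀^Fin 2]→ₗ[ℝ] ℝ) :
    ∃ b : T → T → ℝ, (∀ f : Fin 2 → T, β f = b (f 0) (f 1)) ∧ ∀ x y, b x y = -b y x := by
  have hf : ∀ f : Fin 2 → T, f = ![f 0, f 1] := fun f => by ext k; fin_cases k <;> rfl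
  refine ⟨fun x y => β ![x, y], fun f => congrArg β (hf f), fun x y => ?_⟩
  rw [← β.map_swap ![y, x] (i := 0) (j := 1) (by decide), hf (_ ∘ _)]
  simp

/-- Antisymmetry of `β` makes the six permutation terms coincide in pairs, which cancels the factor
`1! 2! = 2`. -/
theorem wedge_one_two_apply (α : T [⋀^Fin 1]→ₗ[ℝ] ℝ) (β : T [⋀^Fin 2]→ₗ[ℝ] ℝ) (v : Fin 3 → T) :
    wedge (rfl : 1 + 2 = 3) α β v =
      α ![v 0] * β ![v 1, v 2] - α ![v 1] * β ![v 0, v 2] + α ![v 2] * β ![v 0, v 1] := by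
  obtain ⟨a, ha⟩ := altForm_one_eq α
  obtain ⟨b, hb, hs⟩ := altForm_two_eq β
  have h := (factorial_smul_wedge (rfl : 1 + 2 = 3) α β v).trans ((Finset.sum_congr rfl fun σ _ => by
    rw [ha, hb]; rfl).trans (sum_sign_mul_perm_fin_three fun i j k => a (v i) * b (v j) (v k)))
  simp only [ha, hb, Nat.factorial, Matrix.cons_val_zero, Matrix.cons_val_one] at h ⊢
  rw [hs (v 1) (v 0), hs (v 2) (v 0), hs (v 2) (v 1)] at h
  push_cast at h
  linarith

theorem wedge_two_one_apply (α : T [⋀^Fin 1]→ₗ[ℝ] ℝ) (β : T [⋀^Fin 2]→ₗ[ℝ] ℝ) (v : Fin 3 → T) :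
    wedge (rfl : 2 + 1 = 3) β α v =
      α ![v 0] * β ![v 1, v 2] - α ![v 1] * β ![v 0, v 2] + α ![v 2] * β ![v 0, v 1] := by
  obtain ⟨a, ha⟩ := altForm_one_eq α
  obtain ⟨b, hb, hs⟩ := altForm_two_eq β
  have h := (factorial_smul_wedge (rfl : 2 + 1 = 3) β α v).trans ((Finset.sum_congr rfl fun σ _ => by
    rw [ha, hb]; rfl).trans (sum_sign_mul_perm_fin_three fun i j k => b (v i) (v j) * a (v k)))
  simp only [ha, hb, Nat.factorial, Matrix.cons_val_zero, Matrix.cons_val_one] at h ⊢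
  rw [hs (v 1) (v 0), hs (v 2) (v 0), hs (v 2) (v 1)] at h
  push_cast at h
  linarith

/-- The interior product is an antiderivation: `α ∧ i_v θ = α(v) θ` for a form `θ` of top degree. -/
theorem wedge_curryLeft (b : Module.Basis (Fin 3) ℝ T) (θ : T [⋀^Fin 3]→ₗ[ℝ] ℝ)
    (α : T [⋀^Fin 1]→ₗ[ℝ] ℝ) (v : T) :
    wedge (rfl : 1 + 2 = 3) α (θ.curryLeft v) = α ![v] • θ := by
  have hα : α ![v] = ∑ i, b.repr v i * α ![b i] := by
    have h : ∀ x, α ![x] = (AlternatingMap.ofSubsingleton ℝ T ℝ (0 : Fin 1)).symm α x := fun x => by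
      rw [AlternatingMap.ofSubsingleton_symm_apply_apply]
      congr 1
      ext k
      fin_cases k
      rfl
    simp only [h]
    conv_lhs => rw [← b.sum_repr v, map_sum]
    simp only [map_smul, smul_eq_mul]
  refine Module.Basis.ext_alternating b fun p hp => ?_
  -- A top-degree form is a multiple of the determinant, which leaves a finite check on triples of
  -- distinct basis vectors.
  obtain ⟨t, rfl⟩ : ∃ t : ℝ, θ = t • b.det := ⟨_, θ.eq_smul_basis_det b⟩
  have hv : (fun i => b (p i)) = ![b (p 0), b (p 1), b (p 2)] := by
    ext k
    fin_cases k <;> rfl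
  have h01 : p 0 ≠ p 1 := fun h => absurd (hp h) (by decide)
  have h02 : p 0 ≠ p 2 := fun h => absurd (hp h) (by decide)
  have h12 : p 1 ≠ p 2 := fun h => absurd (hp h) (by decide)
  rw [wedge_one_two_apply, hα, hv, Fin.sum_univ_three]
  generalize p 0 = i at *
  generalize p 1 = j at *
  generalize p 2 = k at *
  simp only [AlternatingMap.curryLeft_apply_apply, AlternatingMap.smul_apply, smul_eq_mul,
    Module.Basis.det_apply, Matrix.det_fin_three, Module.Basis.toMatrix_apply]
  fin_cases i <;> fin_cases j <;> fin_cases k <;> simp at h01 h02 h12 ⊢ <;> ring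

theorem curryLeft_wedge (b : Module.Basis (Fin 3) ℝ T) (θ : T [⋀^Fin 3]→ₗ[ℝ] ℝ)
    (α : T [⋀^Fin 1]→ₗ[ℝ] ℝ) (v : T) :
    wedge (rfl : 2 + 1 = 3) (θ.curryLeft v) α = α ![v] • θ := by
  rw [← wedge_curryLeft b]
  ext w
  rw [wedge_one_two_apply, wedge_two_one_apply]

end WedgeAlgebra

/-! ### The volume form, `flat` and `flux` at a point -/

section PointwiseMetric

variable {H : Type*} [TopologicalSpace H] {I : ModelWithCorners ℝ E3 H}
  {M : Type*} [TopologicalSpace M] [ChartedSpace H M]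

theorem orient_neg_neg {x : M} (o : Orient I x) : - -o = o := neg_neg o

variable [IsManifold I ∞ M]
  (g : ContMDiffRiemannianMetric I ∞ E3 (TangentSpace I : M → Type _))

/-- A change of frame `P` turns the Gram matrix `G` into `Pᵀ G P`; its determinant gains `(det P)²`,
and the root gains `|det P|`. -/
theorem sqrtGram_eq_abs_det_mul (x : M) (b b' : Module.Basis (Fin 3) ℝ (TangentSpace I x)) :
    sqrtGram g x b' = |b.det b'| * sqrtGram g x b := by
  have h : (Matrix.of fun i j => g.inner x (b' i) (b' j)) = (b.toMatrix b').transpose *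
      (Matrix.of fun i j => g.inner x (b i) (b j)) * b.toMatrix b' := by
    ext i j
    conv_lhs => rw [Matrix.of_apply, ← b.sum_repr (b' i), ← b.sum_repr (b' j)]
    simp only [map_sum, map_smul, _root_.sum_apply, _root_.smul_apply, smul_eq_mul,
      Matrix.mul_apply, Matrix.transpose_apply, Matrix.of_apply, Module.Basis.toMatrix_apply,
      Finset.sum_mul, Finset.mul_sum]
    refine Finset.sum_congr rfl fun k _ => Finset.sum_congr rfl fun l _ => by ring
  rw [sqrtGram, h, Matrix.det_mul, Matrix.det_mul, Matrix.det_transpose, mul_right_comm,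
    Real.sqrt_mul (mul_self_nonneg _), Real.sqrt_mul_self_eq_abs, Module.Basis.det_apply, sqrtGram]

/-- In a frame `b` with the given orientation, the volume form is `√(det g) dx¹ ∧ dx² ∧ dx³`. -/
theorem vol_orientation (x : M) (b : Module.Basis (Fin 3) ℝ (TangentSpace I x)) :
    vol g x b.orientation = sqrtGram g x b • b.det := by
  rw [vol]
  have ho := (stdBasis I x).orientation_adjustToOrientation b.orientation
  generalize (stdBasis I x).adjustToOrientation b.orientation = b' at ho
  -- Changing frame alters the Gram factor by `|det|` and the coframe by `det`; these agree because
  -- both frames have the same orientation.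
  rw [b'.det.eq_smul_basis_det b, sqrtGram_eq_abs_det_mul g x b' b,
    abs_of_pos ((b'.orientation_eq_iff_det_pos b).1 ho), smul_smul, mul_comm]

theorem exists_orientation_eq (x : M) (o : Orient I x) :
    ∃ b : Module.Basis (Fin 3) ℝ (TangentSpace I x), b.orientation = o :=
  ⟨_, (stdBasis I x).orientation_adjustToOrientation o⟩

theorem vol_neg (x : M) (o : Orient I x) : vol g x (-o) = -vol g x o := by
  rcases (stdBasis I x).orientation_eq_or_eq_neg o with rfl | rfl
  · rw [vol_neg_std, vol_std]
  · rw [orient_neg_neg, vol_neg_std, vol_std, neg_neg]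

theorem flux_neg_orientation (x : M) (o : Orient I x) (v : TangentSpace I x) :
    flux g x (-o) v = -flux g x o v := by
  rw [flux, flux, vol_neg]
  rfl

theorem flux_neg (x : M) (o : Orient I x) (v : TangentSpace I x) :
    flux g x o (-v) = -flux g x o v := by
  rw [flux, map_neg, flux]

/-- The sign of a pseudovector cancels the sign of the volume form, which is why `i_B vol` is
straight. -/
theorem flux_neg_neg (x : M) (o : Orient I x) (v : TangentSpace I x) :
    flux g x (-o) (-v) = flux g x o v := by
  rw [flux_neg_orientation, flux_neg, neg_neg]

theorem flux_add (x : M) (o : Orient I x) (v w : TangentSpace I x) :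
    flux g x o (v + w) = flux g x o v + flux g x o w := by
  rw [flux, map_add, flux, flux]

theorem flux_smul (x : M) (o : Orient I x) (r : ℝ) (v : TangentSpace I x) :
    flux g x o (r • v) = r • flux g x o v := by
  rw [flux, map_smul, flux]

theorem flux_zero (x : M) (o : Orient I x) : flux g x o 0 = 0 := by
  rw [flux, map_zero]

/-- Cyclic pairs of frame vectors read off the components of `v`. Both injectivity of `flux` and
smoothness of its inverse come from this formula. -/
theorem flux_orientation_apply (x : M) (b : Module.Basis (Fin 3) ℝ (TangentSpace I x))
    (v : TangentSpace I x) (i : Fin 3) :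
    flux g x b.orientation v ![b (i + 1), b (i + 2)] = sqrtGram g x b * b.repr v i := by
  rw [flux, vol_orientation]
  simp only [AlternatingMap.curryLeft_apply_apply, AlternatingMap.smul_apply, smul_eq_mul,
    Module.Basis.det_apply, Matrix.det_fin_three, Module.Basis.toMatrix_apply]
  fin_cases i <;> simp

theorem flux_injective (x : M) (o : Orient I x) : Function.Injective (flux g x o) := by
  obtain ⟨b, rfl⟩ := exists_orientation_eq x o
  intro v w h
  refine b.repr.injective (Finsupp.ext fun i => ?_)
  refine mul_left_cancel₀ (sqrtGram_pos g x b).ne' ?_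
  rw [← flux_orientation_apply, h, flux_orientation_apply]

theorem flux_surjective (x : M) (o : Orient I x) : Function.Surjective (flux g x o) := by
  intro β
  obtain ⟨b, rfl⟩ := exists_orientation_eq x o
  obtain ⟨f, hf, hs⟩ := altForm_two_eq β
  -- The coefficients are those forced by `flux_orientation_apply`.
  refine ⟨(sqrtGram g x b)⁻¹ • ∑ i, β ![b (i + 1), b (i + 2)] • b i,
    Module.Basis.ext_alternating b fun p hp => ?_⟩
  have hs0 := (sqrtGram_pos g x b).ne'
  have hp2 : (fun i => b (p i)) = ![b (p 0), b (p 1)] := by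
    ext k
    fin_cases k <;> rfl
  have hne : p 0 ≠ p 1 := fun h => absurd (hp h) (by decide)
  rw [flux, vol_orientation, hp2]
  generalize p 0 = i at *
  generalize p 1 = j at *
  simp only [AlternatingMap.curryLeft_apply_apply, AlternatingMap.smul_apply, smul_eq_mul,
    Module.Basis.det_apply, Matrix.det_fin_three, Module.Basis.toMatrix_apply, hf]
  fin_cases i <;> fin_cases j <;>
    simp [Fin.sum_univ_three, hs0] at hne ⊢ <;>
    first
      | rfl
      | exact (hs _ _).symm

theorem flat_apply (x : M) (v : TangentSpace I x) (w : Fin 1 → TangentSpace I x) :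
    flat g x v w = g.inner x v (w 0) := rfl

theorem flat_neg (x : M) (v : TangentSpace I x) : flat g x (-v) = -flat g x v := by
  ext w
  simp [flat_apply]

theorem flat_injective (x : M) : Function.Injective (flat g x) := by
  intro v w h
  by_contra hne
  refine (g.pos x _ (sub_ne_zero.2 hne)).ne' ?_
  have := DFunLike.congr_fun h ![v - w]
  simp only [flat_apply, Matrix.cons_val_zero] at this
  rw [map_sub, g.symm x _ v, g.symm x _ w, this, sub_self]

theorem flat_surjective (x : M) : Function.Surjective (flat g x) := by
  intro β
  have : FiniteDimensional ℝ (TangentSpace I x) := (stdBasis I x).finiteDimensional_of_finite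
  let L : TangentSpace I x →ₗ[ℝ] Module.Dual ℝ (TangentSpace I x) :=
    (ContinuousLinearMap.coeLM ℝ).comp (g.inner x).toLinearMap
  have hL : Function.Injective L := fun v w h => flat_injective g x (by
    ext u
    exact DFunLike.congr_fun h (u 0))
  obtain ⟨v, hv⟩ := (LinearMap.injective_iff_surjective_of_finrank_eq_finrank
    Subspace.dual_finrank_eq.symm).1 hL
    ((AlternatingMap.ofSubsingleton ℝ (TangentSpace I x) ℝ (0 : Fin 1)).symm β)
  refine ⟨v, ?_⟩
  rw [flat, ← Equiv.eq_symm_apply]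
  exact hv

theorem wedge_flat_flux (x : M) (o : Orient I x) (a v : TangentSpace I x) :
    wedge (rfl : 1 + 2 = 3) (flat g x a) (flux g x o v) = g.inner x a v • vol g x o := by
  rw [flux, wedge_curryLeft (stdBasis I x)]
  rfl

theorem wedge_flux_flat (x : M) (o : Orient I x) (a v : TangentSpace I x) :
    wedge (rfl : 2 + 1 = 3) (flux g x o v) (flat g x a) = g.inner x a v • vol g x o := by
  rw [flux, curryLeft_wedge (stdBasis I x)]
  rfl

end PointwiseMetric

/-! ### Smoothness of `flat`, `flux` and their inverses in charts -/

section ChartSmoothness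

variable {H : Type*} [TopologicalSpace H] {I : ModelWithCorners ℝ E3 H}
  {M : Type*} [TopologicalSpace M] [ChartedSpace H M]

theorem contMDiffOn_det_fin_three {A : M → Matrix (Fin 3) (Fin 3) ℝ} {S : Set M}
    (h : ∀ i j, ContMDiffOn I 𝓘(ℝ, ℝ) ∞ (fun x => A x i j) S) :
    ContMDiffOn I 𝓘(ℝ, ℝ) ∞ (fun x => (A x).det) S := by
  simp only [Matrix.det_fin_three]
  exact ((((((h 0 0).mul (h 1 1)).mul (h 2 2)).sub (((h 0 0).mul (h 1 2)).mul (h 2 1))).sub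
    (((h 0 1).mul (h 1 0)).mul (h 2 2))).add (((h 0 1).mul (h 1 2)).mul (h 2 0))).add
    (((h 0 2).mul (h 1 0)).mul (h 2 1)) |>.sub (((h 0 2).mul (h 1 1)).mul (h 2 0))

variable [IsManifold I ∞ M]

/-- The vector field with constant coordinates `v` in the chart at `x₀`. -/
noncomputable def chartVec (x₀ : M) (v : E3) (x : M) : TangentSpace I x :=
  (triv I x₀).symmL ℝ x v

/-- Smoothness of a vector field on the domain of the chart at `x₀`. -/
def SmoothVecOn (x₀ : M) (s : Π x : M, TangentSpace I x) : Prop :=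
  ContMDiffOn I I.tangent ∞ (fun x => (⟨x, s x⟩ : TangentBundle I M)) (chartAt H x₀).source

/-- Smoothness of a straight form on the domain of the chart at `x₀`. -/
def SmoothFormOn {k : ℕ} (x₀ : M) (η : Π x : M, Alt I k x) : Prop :=
  ∀ v : Fin k → E3, ContDiffOn ℝ ∞ (fun y => rep I η x₀ y v) (extChartAt I x₀).target

theorem mem_triv_baseSet {x₀ x : M} (hx : x ∈ (chartAt H x₀).source) :
    x ∈ (triv I x₀).baseSet := by
  rwa [TangentBundle.trivializationAt_baseSet]

/-- The chart and its inverse are smooth, so coordinate expressions can be tested on the manifold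
itself, along constant-coordinate fields, where bundle calculus is available. -/
theorem smoothFormOn_iff {k : ℕ} {x₀ : M} {η : Π x : M, Alt I k x} :
    SmoothFormOn x₀ η ↔ ∀ v : Fin k → E3, ContMDiffOn I 𝓘(ℝ, ℝ) ∞
      (fun x => η x fun i => chartVec x₀ (v i) x) (chartAt H x₀).source := by
  refine forall_congr' fun v => ⟨fun h => ?_, fun h => ?_⟩
  · refine ((contMDiffOn_iff_contDiffOn.2 h).comp (contMDiffOn_extChartAt (x := x₀)) ?_).congr ?_
    · intro x hx
      exact (extChartAt I x₀).map_source (by rwa [extChartAt_source])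
    · intro x hx
      simp only [Function.comp_apply, rep]
      rw [(extChartAt I x₀).left_inv (by rwa [extChartAt_source])]
      rfl
  · refine contMDiffOn_iff_contDiffOn.1 (h.comp (contMDiffOn_extChartAt_symm x₀) ?_)
    intro y hy
    rw [← extChartAt_source I x₀]
    exact (extChartAt I x₀).map_target hy

theorem coordBasis_apply {x₀ x : M} (hx : x ∈ (triv I x₀).baseSet) (i : Fin 3) :
    coordBasis I x₀ x hx i = chartVec x₀ (EuclideanSpace.basisFun (Fin 3) ℝ i) x := by
  rw [chartVec, Trivialization.symmL_apply _ hx]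
  simp [coordBasis]

theorem coordBasis_repr {x₀ x : M} (hx : x ∈ (triv I x₀).baseSet) (v : TangentSpace I x)
    (i : Fin 3) : (coordBasis I x₀ x hx).repr v i = (triv I x₀ ⟨x, v⟩).2 i := by
  simp [coordBasis]

theorem triv_chartVec {x₀ x : M} (hx : x ∈ (triv I x₀).baseSet) (v : E3) :
    (triv I x₀ ⟨x, chartVec x₀ v x⟩).2 = v := by
  rw [chartVec, Trivialization.symmL_apply _ hx, Trivialization.apply_mk_symm _ hx]

theorem chartOr_of_mem {x₀ x : M} (hx : x ∈ (triv I x₀).baseSet) :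
    chartOr I x₀ x = (coordBasis I x₀ x hx).orientation := dif_pos hx

theorem smoothVecOn_iff {x₀ : M} {s : Π x : M, TangentSpace I x} :
    SmoothVecOn x₀ s ↔ ContMDiffOn I 𝓘(ℝ, E3) ∞
      (fun x => (triv I x₀ ⟨x, s x⟩).2) (chartAt H x₀).source :=
  (triv I x₀).contMDiffOn_section_iff (chartAt H x₀).open_source fun _ hx => mem_triv_baseSet hx

theorem smoothVecOn_iff_coord {x₀ : M} {s : Π x : M, TangentSpace I x} :
    SmoothVecOn x₀ s ↔ ∀ i : Fin 3, ContMDiffOn I 𝓘(ℝ, ℝ) ∞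
      (fun x => (triv I x₀ ⟨x, s x⟩).2 i) (chartAt H x₀).source := by
  rw [smoothVecOn_iff]
  refine ⟨fun h i => (EuclideanSpace.proj (𝕜 := ℝ) i).contMDiff.comp_contMDiffOn h, fun h => ?_⟩
  exact (EuclideanSpace.equiv (Fin 3) ℝ).symm.contDiff.contMDiff.comp_contMDiffOn
    (contMDiffOn_pi_space.2 h)

theorem smoothVecOn_chartVec (x₀ : M) (v : E3) : SmoothVecOn (I := I) x₀ (chartVec x₀ v) :=
  smoothVecOn_iff.2 (contMDiffOn_const.congr fun _ hx => triv_chartVec (mem_triv_baseSet hx) v)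

variable (g : ContMDiffRiemannianMetric I ∞ E3 (TangentSpace I : M → Type _))

theorem SmoothVecOn.inner {x₀ : M} {s t : Π x : M, TangentSpace I x} (hs : SmoothVecOn x₀ s)
    (ht : SmoothVecOn x₀ t) :
    ContMDiffOn I 𝓘(ℝ, ℝ) ∞ (fun x => g.inner x (s x) (t x)) (chartAt H x₀).source := by
  intro x hx
  have : ContMDiffWithinAt I (I.prod 𝓘(ℝ)) ∞ (fun m => TotalSpace.mk' ℝ
      (E := Bundle.Trivial M ℝ) m (g.inner m (s m) (t m))) (chartAt H x₀).source x := by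
    apply ContMDiffWithinAt.clm_bundle_apply₂ (F₁ := E3) (F₂ := E3)
    · exact g.contMDiff.contMDiffAt.contMDiffWithinAt
    · exact hs x hx
    · exact ht x hx
  simp only [contMDiffWithinAt_totalSpace] at this
  exact this.2

theorem SmoothVecOn.flat {x₀ : M} {s : Π x : M, TangentSpace I x} (hs : SmoothVecOn x₀ s) :
    SmoothFormOn x₀ fun x => SplitMaxwell.flat g x (s x) :=
  smoothFormOn_iff.2 fun v => hs.inner g (smoothVecOn_chartVec x₀ (v 0))

/-- The Gram matrix of the coordinate frame of the chart at `x₀`. -/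
noncomputable def chartGram (x₀ x : M) : Matrix (Fin 3) (Fin 3) ℝ :=
  Matrix.of fun i j => g.inner x (chartVec x₀ (EuclideanSpace.basisFun (Fin 3) ℝ i) x)
    (chartVec x₀ (EuclideanSpace.basisFun (Fin 3) ℝ j) x)

theorem sqrtGram_coordBasis {x₀ x : M} (hx : x ∈ (triv I x₀).baseSet) :
    sqrtGram g x (coordBasis I x₀ x hx) = √(chartGram g x₀ x).det := by
  simp only [sqrtGram, coordBasis_apply, chartGram]

theorem chartGram_det_pos {x₀ x : M} (hx : x ∈ (triv I x₀).baseSet) :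
    0 < (chartGram g x₀ x).det := by
  rw [← Real.sqrt_pos, ← sqrtGram_coordBasis g hx]
  exact sqrtGram_pos g x _

theorem contMDiffOn_chartGram_det (x₀ : M) : ContMDiffOn I 𝓘(ℝ, ℝ) ∞
    (fun x => (chartGram g x₀ x).det) (chartAt H x₀).source :=
  contMDiffOn_det_fin_three fun _ _ =>
    (smoothVecOn_chartVec x₀ _).inner g (smoothVecOn_chartVec x₀ _)

theorem contMDiffOn_sqrt_chartGram_det (x₀ : M) : ContMDiffOn I 𝓘(ℝ, ℝ) ∞
    (fun x => √(chartGram g x₀ x).det) (chartAt H x₀).source := fun x hx =>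
  (Real.contDiffAt_sqrt (chartGram_det_pos g (mem_triv_baseSet hx)).ne').contMDiffAt
    |>.comp_contMDiffWithinAt x (contMDiffOn_chartGram_det g x₀ x hx)

/-- In the chart's own orientation no sign appears: `vol` is `√(det g)` times the Euclidean
determinant of the coordinates. -/
theorem vol_chartOr {x₀ x : M} (hx : x ∈ (triv I x₀).baseSet) (w : Fin 3 → TangentSpace I x) :
    vol g x (chartOr I x₀ x) w = √(chartGram g x₀ x).det *
      (EuclideanSpace.basisFun (Fin 3) ℝ).toBasis.det fun j => (triv I x₀ ⟨x, w j⟩).2 := by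
  rw [chartOr_of_mem hx, vol_orientation, sqrtGram_coordBasis, coordBasis]
  rw [AlternatingMap.smul_apply, smul_eq_mul, Module.Basis.det_map]
  rfl

theorem SmoothVecOn.flux {x₀ : M} {s : Π x : M, TangentSpace I x} (hs : SmoothVecOn x₀ s) :
    SmoothFormOn x₀ fun x => SplitMaxwell.flux g x (chartOr I x₀ x) (s x) := by
  refine smoothFormOn_iff.2 fun v => ?_
  -- With `v` fixed, the Euclidean determinant is linear in its first slot, hence smooth in the
  -- coordinates of `s`.
  let L : E3 →ₗ[ℝ] ℝ :=
    { toFun u := (EuclideanSpace.basisFun (Fin 3) ℝ).toBasis.det.curryLeft u v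
      map_add' a b := by rw [map_add]; rfl
      map_smul' r a := by rw [map_smul]; rfl }
  refine ((contMDiffOn_sqrt_chartGram_det g x₀).mul
    (L.toContinuousLinearMap.contMDiff.comp_contMDiffOn (smoothVecOn_iff.1 hs))).congr ?_
  intro x hx
  have hx' : x ∈ (triv I x₀).baseSet := mem_triv_baseSet hx
  rw [SplitMaxwell.flux, AlternatingMap.curryLeft_apply_apply, vol_chartOr g hx']
  congr 1
  change _ = (EuclideanSpace.basisFun (Fin 3) ℝ).toBasis.det (Matrix.vecCons _ v)
  congr 1
  ext j : 1
  refine Fin.cases rfl (fun i => ?_) j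
  exact triv_chartVec hx' (v i)

/-- Each coordinate of `s` is a value of the form on a cyclic pair of coordinate fields, divided by
the positive smooth function `√(det g)`. -/
theorem SmoothVecOn.of_flux {x₀ : M} {s : Π x : M, TangentSpace I x}
    (h : SmoothFormOn x₀ fun x => SplitMaxwell.flux g x (chartOr I x₀ x) (s x)) :
    SmoothVecOn x₀ s := by
  refine smoothVecOn_iff_coord.2 fun i => ?_
  have h2 := smoothFormOn_iff.1 h ![EuclideanSpace.basisFun (Fin 3) ℝ (i + 1),
    EuclideanSpace.basisFun (Fin 3) ℝ (i + 2)]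
  refine (h2.div₀ (contMDiffOn_sqrt_chartGram_det g x₀) fun x hx =>
    (Real.sqrt_pos.2 (chartGram_det_pos g (mem_triv_baseSet hx))).ne').congr ?_
  intro x hx
  have hx' : x ∈ (triv I x₀).baseSet := mem_triv_baseSet hx
  rw [Pi.div_apply, eq_div_iff (Real.sqrt_pos.2 (chartGram_det_pos g hx')).ne', mul_comm,
    ← sqrtGram_coordBasis g hx', ← coordBasis_repr hx', ← flux_orientation_apply,
    chartOr_of_mem hx', coordBasis_apply, coordBasis_apply]
  congr 1
  ext j : 1
  fin_cases j <;> rfl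

theorem chartGram_mulVec {x₀ x : M} (hx : x ∈ (triv I x₀).baseSet) (v : TangentSpace I x)
    (i : Fin 3) : (chartGram g x₀ x).mulVec (fun j => (triv I x₀ ⟨x, v⟩).2 j) i =
      g.inner x v (chartVec x₀ (EuclideanSpace.basisFun (Fin 3) ℝ i) x) := by
  rw [g.symm]
  conv_rhs => rw [← (coordBasis I x₀ x hx).sum_repr v]
  simp only [Matrix.mulVec, dotProduct, map_sum, map_smul, smul_eq_mul, coordBasis_repr,
    coordBasis_apply, chartGram, Matrix.of_apply, mul_comm]

/-- The coordinates of `s` solve a linear system with the Gram matrix as coefficients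
(`chartGram_mulVec`). Cramer's rule writes them as quotients of smooth determinants. -/
theorem SmoothVecOn.of_flat {x₀ : M} {s : Π x : M, TangentSpace I x}
    (h : SmoothFormOn x₀ fun x => SplitMaxwell.flat g x (s x)) : SmoothVecOn x₀ s := by
  refine smoothVecOn_iff_coord.2 fun i => ?_
  have hη : ∀ j : Fin 3, ContMDiffOn I 𝓘(ℝ, ℝ) ∞ (fun x => g.inner x (s x)
      (chartVec x₀ (EuclideanSpace.basisFun (Fin 3) ℝ j) x)) (chartAt H x₀).source := fun j =>
    smoothFormOn_iff.1 h fun _ => EuclideanSpace.basisFun (Fin 3) ℝ j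
  have hc : ContMDiffOn I 𝓘(ℝ, ℝ) ∞ (fun x => ((chartGram g x₀ x).updateCol i fun j =>
      g.inner x (s x) (chartVec x₀ (EuclideanSpace.basisFun (Fin 3) ℝ j) x)).det)
      (chartAt H x₀).source := by
    refine contMDiffOn_det_fin_three fun j k => ?_
    simp only [Matrix.updateCol_apply]
    split_ifs
    · exact hη j
    · exact (smoothVecOn_chartVec x₀ _).inner g (smoothVecOn_chartVec x₀ _)
  refine (hc.div₀ (contMDiffOn_chartGram_det g x₀) fun x hx =>
    (chartGram_det_pos g (mem_triv_baseSet hx)).ne').congr ?_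
  intro x hx
  have hx' : x ∈ (triv I x₀).baseSet := mem_triv_baseSet hx
  rw [Pi.div_apply, eq_div_iff (chartGram_det_pos g hx').ne', mul_comm]
  simp only [← chartGram_mulVec g hx']
  rw [← Matrix.cramer_apply, Matrix.cramer_eq_adjugate_mulVec, Matrix.mulVec_mulVec,
    Matrix.adjugate_mul, Matrix.smul_mulVec, Matrix.one_mulVec]
  rfl

end ChartSmoothness

/-! ### Bijections between smooth fields and smooth forms -/

section Correspondence

variable {H : Type*} [TopologicalSpace H] {I : ModelWithCorners ℝ E3 H}
  {M : Type*} [TopologicalSpace M] [ChartedSpace H M] [IsManifold I ∞ M]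
  (g : ContMDiffRiemannianMetric I ∞ E3 (TangentSpace I : M → Type _))

theorem vectorField_smoothVecOn (A : VectorField I M) (x₀ : M) : SmoothVecOn x₀ A :=
  A.contMDiff.contMDiffOn

theorem exists_vectorField {s : Π x : M, TangentSpace I x} (h : ∀ x₀, SmoothVecOn x₀ s) :
    ∃ A : VectorField I M, ∀ x, A x = s x :=
  ⟨⟨s, fun x => (h x).contMDiffAt ((chartAt H x).open_source.mem_nhds (mem_chart_source H x))⟩,
    fun _ => rfl⟩

/-- The straight `1`-form `A♭`. -/
noncomputable def flatForm (A : VectorField I M) : Form I M 1 :=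
  ⟨fun x => flat g x (A x), fun x₀ => (vectorField_smoothVecOn A x₀).flat g⟩

/-- The twisted `1`-form `A♭`. -/
noncomputable def flatTwisted (A : PseudoVectorField I M) : TwistedForm I M 1 :=
  ⟨fun x o => flat g x (A.1 x o), fun x o =>
    (congrArg (flat g x) (A.2.1 x o)).trans (flat_neg g x _), fun x₀ =>
    SmoothVecOn.flat g (A.2.2 x₀)⟩

/-- The twisted `2`-form `i_U vol`. -/
noncomputable def fluxTwisted (U : VectorField I M) : TwistedForm I M 2 :=
  ⟨fun x o => flux g x o (U x), fun x o => flux_neg_orientation g x o (U x), fun x₀ =>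
    (vectorField_smoothVecOn U x₀).flux g⟩

theorem flux_pseudo (U : PseudoVectorField I M) (x : M) (o o' : Orient I x) :
    flux g x o (U.1 x o) = flux g x o' (U.1 x o') := by
  obtain ⟨b, rfl⟩ := exists_orientation_eq x o
  rcases b.orientation_eq_or_eq_neg o' with rfl | rfl
  · rfl
  · rw [U.2.1, flux_neg_neg]

/-- The straight `2`-form `i_U vol`. -/
noncomputable def fluxForm (U : PseudoVectorField I M) : Form I M 2 :=
  ⟨fun x => flux g x (stdBasis I x).orientation (U.1 x (stdBasis I x).orientation), fun x₀ => by
    -- Smoothness is known for the orientation of one fixed chart, while the definition uses the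
    -- preferred chart at each point; `flux_pseudo` identifies the two.
    have h := SmoothVecOn.flux g (U.2.2 x₀)
    simp only [flux_pseudo g U _ (chartOr I x₀ _) (stdBasis I _).orientation] at h
    exact h⟩

theorem fluxForm_apply (U : PseudoVectorField I M) (x : M) (o : Orient I x) :
    (fluxForm g U).1 x = flux g x o (U.1 x o) :=
  flux_pseudo g U x _ o

/-- Pointwise preimages are automatically smooth by `SmoothVecOn.of_flat`. Surjectivity lets an
arbitrary form derivative be written as the flat of a field. -/
theorem flatForm_surjective : Function.Surjective (flatForm (M := M) g) := by
  intro α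
  choose s hs using fun x => flat_surjective g x (α.1 x)
  obtain ⟨A, hA⟩ := exists_vectorField (s := s) fun x₀ =>
    SmoothVecOn.of_flat g (by simp only [hs]; exact α.2 x₀)
  exact ⟨A, Subtype.ext (funext fun x => by rw [← hs, ← hA]; rfl)⟩

theorem fluxTwisted_surjective : Function.Surjective (fluxTwisted (M := M) g) := by
  intro τ
  choose s hs using fun x => flux_surjective g x (stdBasis I x).orientation
    (τ.1 x (stdBasis I x).orientation)
  -- The preimage is chosen for one orientation only; it serves the other too, since both sides are
  -- odd.
  have hs' : ∀ x o, flux g x o (s x) = τ.1 x o := fun x o => by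
    rcases (stdBasis I x).orientation_eq_or_eq_neg o with rfl | rfl
    · exact hs x
    · rw [flux_neg_orientation, hs, τ.2.1]
  obtain ⟨U, hU⟩ := exists_vectorField (s := s) fun x₀ =>
    SmoothVecOn.of_flux g (by simp only [hs']; exact τ.2.2 x₀)
  exact ⟨U, Subtype.ext (funext fun x => funext fun o => by rw [← hs', ← hU]; rfl)⟩

theorem flatTwisted_surjective : Function.Surjective (flatTwisted (M := M) g) := by
  intro τ
  choose s hs using fun x o => flat_surjective g x (τ.1 x o)
  refine ⟨⟨s, fun x o => flat_injective g x ?_, fun x₀ => SmoothVecOn.of_flat g (x₀ := x₀)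
    (s := fun x => s x (chartOr I x₀ x)) ?_⟩, Subtype.ext (funext fun x => funext fun o => hs x o)⟩
  · rw [hs, flat_neg, hs, τ.2.1]
  · simp only [hs]
    exact τ.2.2 x₀

theorem fluxForm_surjective : Function.Surjective (fluxForm (M := M) g) := by
  intro η
  choose s hs using fun x o => flux_surjective g x o (η.1 x)
  -- Preimages are chosen independently for the two orientations, and injectivity then forces `s` to
  -- be odd.
  refine ⟨⟨s, fun x o => flux_injective g x (-o) ?_, fun x₀ => SmoothVecOn.of_flux g (x₀ := x₀)
    (s := fun x => s x (chartOr I x₀ x)) ?_⟩, Subtype.ext (funext fun x => hs x _)⟩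
  · rw [hs, flux_neg_neg, hs]
  · simp only [hs]
    exact η.2 x₀

theorem fluxTwisted_add_smul (D U : VectorField I M) (r : ℝ) :
    fluxTwisted g (D + r • U) = fluxTwisted g D + r • fluxTwisted g U :=
  Subtype.ext (funext fun x => funext fun o => by
    change flux g x o (D x + r • U x) = flux g x o (D x) + r • flux g x o (U x)
    rw [flux_add, flux_smul])

theorem fluxForm_add_smul (D U : PseudoVectorField I M) (r : ℝ) :
    fluxForm g (D + r • U) = fluxForm g D + r • fluxForm g U :=
  Subtype.ext (funext fun x => by
    let o := (stdBasis I x).orientation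
    change flux g x o (D.1 x o + r • U.1 x o) = flux g x o (D.1 x o) + r • flux g x o (U.1 x o)
    rw [flux_add, flux_smul])

/-- Injectivity preserves supports, so admissible variations correspond to admissible variations. -/
theorem fluxTwisted_ne_zero_iff (U : VectorField I M) (x : M) :
    (fluxTwisted g U).1 x ≠ 0 ↔ U x ≠ 0 := by
  refine not_congr ⟨fun h => flux_injective g x (stdBasis I x).orientation ?_, fun h => ?_⟩
  · rw [flux_zero]
    exact congrFun h _
  · funext o
    change flux g x o (U x) = 0
    rw [h, flux_zero]

theorem fluxForm_ne_zero_iff (U : PseudoVectorField I M) (x : M) :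
    (fluxForm g U).1 x ≠ 0 ↔ U.1 x ≠ 0 := by
  refine not_congr ⟨fun h => funext fun o => flux_injective g x o ?_, fun h => ?_⟩
  · rw [← fluxForm_apply, h]
    exact (flux_zero g x o).symm
  · rw [fluxForm_apply g U x (stdBasis I x).orientation, h]
    exact flux_zero g x _

theorem statesCorrespond_iff (p : VectorState I M) (q : FormState I M) :
    StatesCorrespond g p q ↔ q = (fluxTwisted g p.1, fluxForm g p.2) := by
  constructor
  · rintro ⟨h₁, h₂⟩
    refine Prod.ext (Subtype.ext (funext fun x => funext fun o => h₁ x o))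
      (Subtype.ext (funext fun x => h₂ x _))
  · rintro rfl
    exact ⟨fun _ _ => rfl, fun x o => fluxForm_apply g p.2 x o⟩

end Correspondence

/-! ### Density of the interior of a manifold with corners -/

section Interior

variable {H : Type*} [TopologicalSpace H] {I : ModelWithCorners ℝ E3 H}

/-- The model range lies in the closure of its interior, so even at a boundary point a relative
neighbourhood contains a genuine open set. -/
theorem exists_isOpen_subset_of_mem_nhdsWithin_range {y : E3} (hy : y ∈ Set.range I) {P : Set E3}
    (hP : P ∈ 𝓝[Set.range I] y) :
    ∃ O : Set E3, IsOpen O ∧ O.Nonempty ∧ O ⊆ P := by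
  obtain ⟨O, hO, hyO, hOP⟩ := mem_nhdsWithin.1 hP
  refine ⟨O ∩ interior (Set.range I), hO.inter isOpen_interior,
    mem_closure_iff.1 (I.range_subset_closure_interior hy) O hO hyO,
    fun z hz => hOP ⟨hz.1, interior_subset hz.2⟩⟩

variable {M : Type*} [TopologicalSpace M] [ChartedSpace H M]

theorem dense_interior [IsManifold I ∞ M] : Dense (I.interior M) := by
  intro x
  refine mem_closure_iff.2 fun U hU hxU => ?_
  have hP : (extChartAt I x).target ∩ (extChartAt I x).symm ⁻¹' U ∈
      𝓝[Set.range I] (extChartAt I x x) := by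
    refine Filter.inter_mem (extChartAt_target_mem_nhdsWithin x) ?_
    refine nhdsWithin_le_nhds ((continuousAt_extChartAt_symm x).preimage_mem_nhds ?_)
    rw [extChartAt_to_inv]
    exact hU.mem_nhds hxU
  obtain ⟨O, hO, ⟨y, hy⟩, hOP⟩ :=
    exists_isOpen_subset_of_mem_nhdsWithin_range (extChartAt_target_subset_range x
      (mem_extChartAt_target x)) hP
  refine ⟨(extChartAt I x).symm y, (hOP hy).2, ?_⟩
  have hs := (extChartAt I x).map_target (hOP hy).1
  -- Being an interior point can be tested in any chart of the atlas, here the one at `x`.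
  refine (ModelWithCorners.isInteriorPoint_iff_of_mem_atlas (n := ∞) (by simp)
    (chart_mem_atlas H x) (by rwa [extChartAt_source] at hs)).2 ?_
  change extChartAt I x ((extChartAt I x).symm y) ∈ _
  rw [(extChartAt I x).right_inv (hOP hy).1]
  exact interior_maximal (fun z hz => (hOP hz).1) hO hy

theorem measurableSet_extChartAt_target (x : M) : MeasurableSet (extChartAt I x).target := by
  rw [extChartAt_target]
  exact ((chartAt H x).open_target.preimage I.continuous_symm).measurableSet.inter
    I.isClosed_range.measurableSet

end Interior

/-! ### Integrals of densities -/

section DensityIntegral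

variable {H : Type*} [TopologicalSpace H] {I : ModelWithCorners ℝ E3 H}
  {M : Type*} [TopologicalSpace M] [ChartedSpace H M] [IsManifold I ∞ M]
  [T2Space M] [SigmaCompactSpace M]

/-- Integrals and series take the value `0` when they do not converge, so subtraction needs absolute
convergence at both levels. -/
theorem densityIntegral_sub {ρ σ : Π x : M, Orient I x → Alt I 3 x} (hρ : DensityIntegrable I ρ)
    (hσ : DensityIntegrable I σ) :
    densityIntegral I (fun x o => ρ x o - σ x o) = densityIntegral I ρ - densityIntegral I σ := by
  have hsum : ∀ {τ : Π x : M, Orient I x → Alt I 3 x}, DensityIntegrable I τ →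
      Summable fun i : M => ∫ y in (extChartAt I i).target, localDensity I τ i y := fun h =>
    Summable.of_norm_bounded h.2 fun i => norm_integral_le_integral_norm _
  rw [densityIntegral, densityIntegral, densityIntegral, ← (hsum hρ).tsum_sub (hsum hσ)]
  refine tsum_congr fun i => ?_
  rw [← integral_sub (hρ.1 i) (hσ.1 i)]
  refine integral_congr_ae (Filter.Eventually.of_forall fun y => ?_)
  simp only [localDensity]
  rw [← mul_sub]
  rfl

variable (g : ContMDiffRiemannianMetric I ∞ E3 (TangentSpace I : M → Type _))

theorem localDensity_volDensity (f : M → ℝ) (i : M) {y : E3} (hy : y ∈ (extChartAt I i).target) :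
    localDensity I (volDensity g fun x _ => f x) i y =
      partUnity I M i ((extChartAt I i).symm y) * (f ((extChartAt I i).symm y) *
        √(chartGram g i ((extChartAt I i).symm y)).det) := by
  have hx : (extChartAt I i).symm y ∈ (triv I i).baseSet := by
    refine mem_triv_baseSet ?_
    rw [← extChartAt_source I i]
    exact (extChartAt I i).map_target hy
  have h : repTw I (volDensity g fun x _ => f x) i y
      (fun j => EuclideanSpace.basisFun (Fin 3) ℝ j) = f ((extChartAt I i).symm y) *
        vol g _ (chartOr I i ((extChartAt I i).symm y))
          (fun j => chartVec i (EuclideanSpace.basisFun (Fin 3) ℝ j) _) := rfl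
  rw [localDensity, h, vol_chartOr g hx]
  simp only [triv_chartVec hx]
  have hd := (EuclideanSpace.basisFun (Fin 3) ℝ).toBasis.det_self
  rw [OrthonormalBasis.coe_toBasis] at hd
  rw [hd, mul_one]

theorem continuousOn_localDensity_volDensity {f : M → ℝ} (hf : Continuous f) (i : M) :
    ContinuousOn (localDensity I (volDensity g fun x _ => f x) i) (extChartAt I i).target := by
  refine ContinuousOn.congr ?_ fun y hy => localDensity_volDensity g f i hy
  have hm : Set.MapsTo (extChartAt I i).symm (extChartAt I i).target (chartAt H i).source := by
    rw [← extChartAt_source I i]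
    exact fun y hy => (extChartAt I i).map_target hy
  have hc := continuousOn_extChartAt_symm (I := I) i
  exact ((partUnity I M i).contMDiff.continuous.comp_continuousOn hc).mul
    ((hf.comp_continuousOn hc).mul
      ((contMDiffOn_sqrt_chartGram_det g i).continuousOn.comp hc hm))

/-- Each local density is continuous and vanishes off a compact set in its chart; local finiteness
of the partition leaves finitely many nonzero terms. -/
theorem densityIntegrable_volDensity {f : M → ℝ} (hf : Continuous f) {K : Set M}
    (hK : IsCompact K) (hfK : Function.support f ⊆ K) :
    DensityIntegrable I (volDensity g fun x _ => f x) := by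
  refine ⟨fun i => ?_, ?_⟩
  · have hS : IsCompact (K ∩ tsupport (partUnity I M i)) := hK.inter_right (isClosed_tsupport _)
    have hSs : K ∩ tsupport (partUnity I M i) ⊆ (extChartAt I i).source := by
      rw [extChartAt_source]
      exact Set.inter_subset_right.trans (partUnity_isSubordinate I M i)
    have hS' := hS.image_of_continuousOn ((continuousOn_extChartAt (I := I) i).mono hSs)
    have hSt : extChartAt I i '' (K ∩ tsupport (partUnity I M i)) ⊆ (extChartAt I i).target := by
      rintro _ ⟨x, hx, rfl⟩
      exact (extChartAt I i).map_source (hSs hx)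
    refine (((continuousOn_localDensity_volDensity g hf i).mono hSt).integrableOn_compact
      hS').of_forall_sdiff_eq_zero (measurableSet_extChartAt_target i) fun y hy => ?_
    rw [localDensity_volDensity g f i hy.1]
    by_contra hne
    refine hy.2 ⟨(extChartAt I i).symm y, ⟨hfK fun h0 => hne ?_, subset_tsupport _ fun h0 => hne ?_⟩,
      (extChartAt I i).right_inv hy.1⟩
    · rw [h0, zero_mul, mul_zero]
    · rw [h0, zero_mul]
  · refine summable_of_hasFiniteSupport (((partUnity I M).locallyFinite.finite_nonempty_inter_compact
      hK).subset fun i hi => ?_)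
    by_contra hne
    refine hi (setIntegral_eq_zero_of_forall_eq_zero fun y hy => ?_)
    rw [localDensity_volDensity g f i hy, abs_eq_zero]
    by_contra h0
    refine hne ⟨(extChartAt I i).symm y, fun h1 => h0 ?_, hfK fun h1 => h0 ?_⟩
    · rw [h1, zero_mul]
    · rw [h1, zero_mul, mul_zero]

theorem densityIntegral_volDensity_pos {f : M → ℝ} (hf : Continuous f) {K : Set M}
    (hK : IsCompact K) (hfK : Function.support f ⊆ K) (h0 : ∀ x, 0 ≤ f x) {x : M} (hx : 0 < f x) :
    0 < densityIntegral I (volDensity g fun x _ => f x) := by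
  obtain ⟨hi, hsum⟩ := densityIntegrable_volDensity g hf hK hfK
  have hnn : ∀ i, ∀ y ∈ (extChartAt I i).target,
      0 ≤ localDensity I (volDensity g fun x _ => f x) i y := fun i y hy => by
    rw [localDensity_volDensity g f i hy]
    exact mul_nonneg ((partUnity I M).nonneg i _) (mul_nonneg (h0 _) (Real.sqrt_nonneg _))
  obtain ⟨i, hix⟩ := (partUnity I M).exists_pos_of_mem (Set.mem_univ x)
  have hxs : x ∈ (extChartAt I i).source := by
    rw [extChartAt_source]
    exact partUnity_isSubordinate I M i (subset_tsupport _ hix.ne')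
  have hyt := (extChartAt I i).map_source hxs
  have hsum' : Summable fun i : M => ∫ y in (extChartAt I i).target,
      localDensity I (volDensity g fun x _ => f x) i y :=
    Summable.of_norm_bounded hsum fun i => norm_integral_le_integral_norm _
  refine hsum'.tsum_pos (fun j => setIntegral_nonneg (measurableSet_extChartAt_target j) (hnn j)) i ?_
  rw [setIntegral_pos_iff_support_of_nonneg_ae
    ((ae_restrict_iff' (measurableSet_extChartAt_target i)).2
      (Filter.Eventually.of_forall (hnn i))) (hi i)]
  have hpos : 0 < localDensity I (volDensity g fun x _ => f x) i (extChartAt I i x) := by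
    rw [localDensity_volDensity g f i hyt, (extChartAt I i).left_inv hxs]
    refine mul_pos hix (mul_pos hx (Real.sqrt_pos.2 (chartGram_det_pos g (mem_triv_baseSet ?_))))
    rwa [← extChartAt_source I i]
  -- The image of `x` may be a boundary point, so positivity near it is moved to a nonempty open
  -- subset of `E3`, which has positive measure.
  have hev := (continuousOn_localDensity_volDensity g hf i _ hyt).eventually (lt_mem_nhds hpos)
  have hP := Filter.inter_mem hev self_mem_nhdsWithin
  rw [nhdsWithin_extChartAt_target_eq' hxs] at hP
  obtain ⟨O, hO, hOne, hOP⟩ := exists_isOpen_subset_of_mem_nhdsWithin_range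
    (extChartAt_target_subset_range i hyt) hP
  exact (hO.measure_pos volume hOne).trans_le
    (measure_mono fun y hy => ⟨(hOP hy).1.ne', (hOP hy).2⟩)

/-- A continuous nonnegative function is tested by smooth functions with compact support in the
interior. -/
theorem exists_bump_densityIntegral_pos {q : M → ℝ} (hq : Continuous q) (h0 : ∀ x, 0 ≤ q x)
    {x : M} (hx : q x ≠ 0) :
    ∃ f : M → ℝ, ContMDiff I 𝓘(ℝ, ℝ) ∞ f ∧ CompactInInterior I (Function.support f) ∧
      0 < densityIntegral I (volDensity g fun x _ => f x * q x) := by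
  -- The set where `q` is nonzero is open, so it contains an interior point at which the bump can be
  -- centred.
  obtain ⟨z, hzq, hzI⟩ := dense_interior (I := I) |>.inter_open_nonempty _
    (isOpen_compl_singleton.preimage hq) ⟨x, hx⟩
  obtain ⟨f, -, hf⟩ := (SmoothBumpFunction.nhds_basis_tsupport (I := I) z).mem_iff.1
    ((ModelWithCorners.isOpen_interior (n := ∞) (by simp)).mem_nhds hzI)
  refine ⟨f, f.contMDiff, ⟨tsupport f, f.hasCompactSupport, hf, subset_tsupport _⟩, ?_⟩
  refine densityIntegral_volDensity_pos g (f.contMDiff.continuous.mul hq) f.hasCompactSupport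
    ?_ (fun y => mul_nonneg f.nonneg (h0 y)) (x := z) ?_
  · intro y hy
    exact subset_tsupport _ fun h => hy (by simp [h])
  · exact mul_pos (by simp) (lt_of_le_of_ne (h0 z) (Ne.symm hzq))

end DensityIntegral

/-! ### Functional derivatives and their uniqueness -/

section Derivatives

variable {H : Type*} [TopologicalSpace H] {I : ModelWithCorners ℝ E3 H}
  {M : Type*} [TopologicalSpace M] [ChartedSpace H M] [IsManifold I ∞ M]
  (g : ContMDiffRiemannianMetric I ∞ E3 (TangentSpace I : M → Type _))

theorem volDensity_sub (f h : Π x : M, Orient I x → ℝ) :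
    volDensity g (fun x o => f x o - h x o) =
      fun x o => volDensity g f x o - volDensity g h x o :=
  funext fun _ => funext fun _ => AlternatingMap.ext fun _ => sub_mul _ _ _

theorem wedgeDensity_flatForm_fluxTwisted (A U : VectorField I M) :
    wedgeDensity I (rfl : 1 + 2 = 3) (flatForm g A).1 (fluxTwisted g U).1 =
      volDensity g fun x _ => g.inner x (A x) (U x) :=
  funext fun x => funext fun o => wedge_flat_flux g x o (A x) (U x)

theorem wedgeDensity_fluxForm_flatTwisted (A U : PseudoVectorField I M) :
    wedgeDensity I (rfl : 2 + 1 = 3) (fluxForm g U).1 (flatTwisted g A).1 =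
      volDensity g fun x o => g.inner x (A.1 x o) (U.1 x o) := by
  funext x o
  rw [wedgeDensity, fluxForm_apply g U x o]
  exact wedge_flux_flat g x o _ _

/-- `A♭ ∧ dB♭ = (A · curl B) vol`. -/
theorem wedgeDensity_flatForm_dTw_flatTwisted (A : VectorField I M) (B : PseudoVectorField I M) :
    wedgeDensity I (rfl : 1 + 2 = 3) (flatForm g A).1 (dTw I (flatTwisted g B).1) =
      dotCurlDensity g A B := by
  funext x o
  have h := flux_curl g B.1 x o
  rw [wedgeDensity]
  change wedge _ _ (dTw I (fun x o => flat g x (B.1 x o)) x o) = _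
  rw [← h]
  exact wedge_flat_flux g x o _ _

theorem inner_pseudo (A U : PseudoVectorField I M) (x : M) (o o' : Orient I x) :
    g.inner x (A.1 x o) (U.1 x o) = g.inner x (A.1 x o') (U.1 x o') := by
  obtain ⟨b, rfl⟩ := exists_orientation_eq x o
  rcases b.orientation_eq_or_eq_neg o' with rfl | rfl
  · rfl
  · rw [A.2.1, U.2.1]
    simp

theorem continuous_inner_vectorField (A U : VectorField I M) :
    Continuous fun x => g.inner x (A x) (U x) :=
  continuous_iff_continuousAt.2 fun x => ((vectorField_smoothVecOn A x).inner g
    (vectorField_smoothVecOn U x)).continuousOn.continuousAt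
      ((chartAt H x).open_source.mem_nhds (mem_chart_source H x))

theorem continuous_inner_pseudoVectorField (A U : PseudoVectorField I M) :
    Continuous fun x => g.inner x (A.1 x (chartOr I x x)) (U.1 x (chartOr I x x)) := by
  refine continuous_iff_continuousAt.2 fun x => ?_
  have h := (SmoothVecOn.inner g (A.2.2 x) (U.2.2 x)).continuousOn.continuousAt
    ((chartAt H x).open_source.mem_nhds (mem_chart_source H x))
  -- The preferred orientation may jump with `y`; the inner product of two pseudovectors does not
  -- see it.
  exact h.congr (Filter.Eventually.of_forall fun y => inner_pseudo g A U y _ _)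

theorem inner_self_ne_zero {x : M} {v : TangentSpace I x} (h : v ≠ 0) : g.inner x v v ≠ 0 :=
  (g.pos x v h).ne'

theorem inner_self_nonneg (x : M) (v : TangentSpace I x) : 0 ≤ g.inner x v v := by
  by_cases h : v = 0
  · simp [h]
  · exact (g.pos x v h).le

variable [T2Space M] [SigmaCompactSpace M]

/-- A change of variables along a surjective, linear, support-preserving map, under which the two
derivative pairings have the same density. -/
theorem hasDerivAtTwisted_iff (K : TwistedForm I M 2 → ℝ) (D A : VectorField I M) :
    HasDerivAtTwisted (rfl : 1 + 2 = 3) K (fluxTwisted g D) (flatForm g A) ↔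
      HasVectorDeriv g (fun D => K (fluxTwisted g D)) D A := by
  rw [HasDerivAtTwisted, (fluxTwisted_surjective g).forall]
  simp only [fluxTwisted_ne_zero_iff, pairing, wedgeDensity_flatForm_fluxTwisted,
    ← fluxTwisted_add_smul]
  rfl

theorem hasDerivAtStraight_iff (K : Form I M 2 → ℝ) (B A : PseudoVectorField I M) :
    HasDerivAtStraight (rfl : 2 + 1 = 3) K (fluxForm g B) (flatTwisted g A) ↔
      HasPseudoVectorDeriv g (fun B => K (fluxForm g B)) B A := by
  rw [HasDerivAtStraight, (fluxForm_surjective g).forall]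
  simp only [fluxForm_ne_zero_iff, pairing, wedgeDensity_fluxForm_flatTwisted,
    ← fluxForm_add_smul]
  rfl

theorem hasFormDerivs_iff {F : VectorState I M → ℝ} {F' : FormState I M → ℝ}
    (hF : FunctionalsCorrespond g F F') {p : VectorState I M} {q : FormState I M}
    (hpq : StatesCorrespond g p q) (A : VectorState I M) :
    HasFormDerivs F' q (flatForm g A.1, flatTwisted g A.2) ↔ HasVectorDerivs g F p A := by
  have h : ∀ D B, F' (fluxTwisted g D, fluxForm g B) = F (D, B) := fun D B =>
    hF (D, B) _ ((statesCorrespond_iff g _ _).2 rfl)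
  obtain rfl := (statesCorrespond_iff g p q).1 hpq
  rw [HasFormDerivs, hasDerivAtTwisted_iff, hasDerivAtStraight_iff]
  simp only [h]
  rfl

/-- The functional derivative with respect to a vector field is unique. -/
theorem HasVectorDeriv.unique {K : VectorField I M → ℝ} {D A A' : VectorField I M}
    (h : HasVectorDeriv g K D A) (h' : HasVectorDeriv g K D A') : A = A' := by
  by_contra hne
  obtain ⟨x, hx⟩ : ∃ x, (A - A') x ≠ 0 := by
    by_contra! h0
    exact hne (sub_eq_zero.1 (ContMDiffSection.ext h0))
  obtain ⟨f, hf, ⟨S, hS, hSI, hfS⟩, hpos⟩ := exists_bump_densityIntegral_pos g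
    (continuous_inner_vectorField g (A - A') (A - A')) (fun _ => inner_self_nonneg g _ _)
    (inner_self_ne_zero g hx)
  -- In this direction the two derivative formulas differ by `∫ f |A - A'|² vol > 0`, although both
  -- give the same derivative.
  obtain ⟨U, hU⟩ := exists_vectorField (s := fun x => f x • (A - A') x) fun x₀ =>
    hf.contMDiffOn.smul_section (vectorField_smoothVecOn (A - A') x₀)
  have hUS : ∀ x, U x ≠ 0 → x ∈ S := fun x hx => hfS fun h0 => hx (by
    rw [hU, h0, zero_smul])
  have hint : ∀ C : VectorField I M, DensityIntegrable I
      (volDensity g fun x _ => g.inner x (C x) (U x)) := fun C =>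
    densityIntegrable_volDensity g (continuous_inner_vectorField g C U) hS fun x hx =>
      hUS x fun h0 => hx (by simp [h0])
  have heq := (h U ⟨S, hS, hSI, hUS⟩).unique (h' U ⟨S, hS, hSI, hUS⟩)
  rw [← sub_eq_zero, ← densityIntegral_sub (hint A) (hint A'), ← volDensity_sub] at heq
  refine hpos.ne' (Eq.trans (congrArg (fun q => densityIntegral I (volDensity g q)) (
    funext fun x => funext fun o => ?_)) heq)
  rw [hU, map_smul, map_smul, ← smul_sub, smul_eq_mul, g.symm x (A x), g.symm x (A' x), ← map_sub]
  rfl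

/-- The functional derivative with respect to a pseudovector field is unique. -/
theorem HasPseudoVectorDeriv.unique {K : PseudoVectorField I M → ℝ} {B A A' : PseudoVectorField I M}
    (h : HasPseudoVectorDeriv g K B A) (h' : HasPseudoVectorDeriv g K B A') : A = A' := by
  by_contra hne
  obtain ⟨x, o, hx⟩ : ∃ x o, (A - A').1 x o ≠ 0 := by
    by_contra! h0
    exact hne (sub_eq_zero.1 (Subtype.ext (funext fun x => funext fun o => h0 x o)))
  have hx' : g.inner x ((A - A').1 x (chartOr I x x)) ((A - A').1 x (chartOr I x x)) ≠ 0 := by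
    rw [inner_pseudo g _ _ x _ o]
    exact inner_self_ne_zero g hx
  obtain ⟨f, hf, ⟨S, hS, hSI, hfS⟩, hpos⟩ := exists_bump_densityIntegral_pos g
    (continuous_inner_pseudoVectorField g (A - A') (A - A')) (fun _ => inner_self_nonneg g _ _) hx'
  let U : PseudoVectorField I M := ⟨fun x o => f x • (A - A').1 x o,
    fun x o => by
      change f x • (A - A').1 x (-o) = -(f x • (A - A').1 x o)
      rw [(A - A').2.1, smul_neg],
    fun x₀ => hf.contMDiffOn.smul_section ((A - A').2.2 x₀)⟩
  have hUS : ∀ x, U.1 x ≠ 0 → x ∈ S := fun x hx => hfS fun h0 => hx (funext fun o => by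
    change f x • (A - A').1 x o = 0
    rw [h0, zero_smul])
  have hint : ∀ C : PseudoVectorField I M, DensityIntegrable I
      (volDensity g fun x o => g.inner x (C.1 x o) (U.1 x o)) := fun C => by
    have hc := densityIntegrable_volDensity g (continuous_inner_pseudoVectorField g C U) hS
      fun x hx => hUS x fun h0 => hx (by simp [h0])
    rwa [show (fun x o => g.inner x (C.1 x o) (U.1 x o)) = fun x _ => g.inner x
      (C.1 x (chartOr I x x)) (U.1 x (chartOr I x x)) from
        funext fun x => funext fun o => inner_pseudo g C U x _ _]
  have heq := (h U ⟨S, hS, hSI, hUS⟩).unique (h' U ⟨S, hS, hSI, hUS⟩)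
  rw [← sub_eq_zero, ← densityIntegral_sub (hint A) (hint A'), ← volDensity_sub] at heq
  refine hpos.ne' (Eq.trans (congrArg (fun q => densityIntegral I (volDensity g q)) (
    funext fun x => funext fun o => ?_)) heq)
  rw [inner_pseudo g _ _ x _ o]
  change _ = g.inner x (A.1 x o) (f x • (A - A').1 x o) -
    g.inner x (A'.1 x o) (f x • (A - A').1 x o)
  rw [map_smul, map_smul, ← smul_sub, smul_eq_mul, g.symm x (A.1 x o), g.symm x (A'.1 x o),
    ← map_sub]
  rfl

/-- Every candidate is the flat of some pair of fields, so uniqueness reduces to the vector side. -/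
theorem hasFormDerivs_iff_eq {F : VectorState I M → ℝ} {F' : FormState I M → ℝ}
    (hF : FunctionalsCorrespond g F F') {p : VectorState I M} {q : FormState I M}
    (hpq : StatesCorrespond g p q) {A : VectorState I M} (hA : HasVectorDerivs g F p A)
    (α : FormCostate I M) :
    HasFormDerivs F' q α ↔ α = (flatForm g A.1, flatTwisted g A.2) := by
  refine ⟨fun h => ?_, fun h => h ▸ (hasFormDerivs_iff g hF hpq A).2 hA⟩
  obtain ⟨α₁, α₂⟩ := α
  obtain ⟨A₁, rfl⟩ := flatForm_surjective g α₁
  obtain ⟨A₂, rfl⟩ := flatTwisted_surjective g α₂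
  have h' := (hasFormDerivs_iff g hF hpq (A₁, A₂)).1 h
  rw [HasVectorDeriv.unique g hA.1 h'.1, HasPseudoVectorDeriv.unique g hA.2 h'.2]

end Derivatives

end SplitMaxwell

theorem mainTheorem5 {H : Type*} [TopologicalSpace H] {I : ModelWithCorners ℝ E3 H}
    {M : Type*} [TopologicalSpace M] [ChartedSpace H M] [IsManifold I ∞ M]
    [T2Space M] [SigmaCompactSpace M]
    (g : ContMDiffRiemannianMetric I ∞ E3 (TangentSpace I : M → Type _)) (c : ℝ)
    (F G : VectorState I M → ℝ) (F' G' : FormState I M → ℝ)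
    (hF : FunctionalsCorrespond g F F') (hG : FunctionalsCorrespond g G G')
    (p : VectorState I M) (q : FormState I M) (hpq : StatesCorrespond g p q)
    (A C : VectorState I M) (hA : HasVectorDerivs g F p A) (hC : HasVectorDerivs g G p C)
    (hAC : DensityIntegrable I (dotCurlDensity g A.1 C.2))
    (hCA : DensityIntegrable I (dotCurlDensity g C.1 A.2)) :
    (∃! α : FormCostate I M, HasFormDerivs F' q α) ∧
    (∃! γ : FormCostate I M, HasFormDerivs G' q γ) ∧
    ∀ α γ : FormCostate I M, HasFormDerivs F' q α → HasFormDerivs G' q γ →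
      DensityIntegrable I (wedgeDensity I (rfl : 1 + 2 = 3) α.1.1 (dTw I γ.2.1)) ∧
      DensityIntegrable I (wedgeDensity I (rfl : 1 + 2 = 3) γ.1.1 (dTw I α.2.1)) ∧
      formBracket c α γ = vectorBracket g c A C := by
  have hα := hasFormDerivs_iff_eq g hF hpq hA
  have hγ := hasFormDerivs_iff_eq g hG hpq hC
  refine ⟨⟨_, (hα _).2 rfl, fun α h => (hα α).1 h⟩, ⟨_, (hγ _).2 rfl, fun γ h => (hγ γ).1 h⟩,
    fun α γ h h' => ?_⟩
  obtain rfl := (hα α).1 h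
  obtain rfl := (hγ γ).1 h'
  -- The form densities are now literally the vector ones; only linearity of the integral remains.
  simp only [formBracket, vectorBracket, pairing, wedgeDensity_flatForm_dTw_flatTwisted]
  refine ⟨hAC, hCA, ?_⟩
  rw [volDensity_sub]
  exact congrArg _ (densityIntegral_sub hAC hCA).symm
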